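/- For an integer $h\ge 1$ let $\mathcal G_h$ be the half-infinite grid graph with vertex set $\mathbb N\times\{0,\dots,h-1\}$ (where $0\in\mathbb N$), two vertices being adjacent exactly when their Euclidean distance is $1$. A growing self-avoiding walk (GSAW) on $\mathcal G_h$ is a finite directed walk that visits no vertex twice and whose endpoint is trapped, i.e. every neighbour of the endpoint lies on the walk. Let $W_{(0,h-1)}(\mathcal G_h)$ be the set of GSAWs on $\mathcal G_h$ that start at the top-left corner $(0,h-1)$. For such a walk $W=(v_0,\dots,v_n)$ let $|W|=n$ be its number of edges, let $\|W\|$ be its displacement, the difference between the largest and the smallest $x$-coordinate of its vertices, and let $$p^U_h(W)=\prod_{i=0}^{n-1}\frac{1}{\#\{u : u \text{ is a neighbour of } v_i \text{ in } \mathcal G_h \text{ and } u\notin\{v_0,\dots,v_i\}\}}$$ be its probability under the uniform model, in which each step is chosen uniformly among the unoccupied neighbours of the current endpoint. **Theorem.** For every $h\ge 1$, the generating function $$f^U_h(x,y)=\sum_{W\in W_{(0,h-1)}(\mathcal G_h)}p^U_h(W)\,x^{|W|}y^{\|W\|}=\sum_{n,k\ge 0}\Bigl(\sum_{|W|=n,\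 \|W\|=k}p^U_h(W)\Bigr)x^ny^k\in\mathbb Q[[x,y]]$$ (each inner sum on the right being finite) is rational: there are polynomials $P,Q\in\mathbb Q[x,y]$ with $Q(0,0)\ne 0$ such that $f^U_h=P/Q$ in $\mathbb Q[[x,y]]$. -/

import Mathlib

/-- The grid graph on a set `S` of integer points of the plane: two points are adjacent
exactly when their Euclidean distance is `1`. -/
def gridGraph (S : Set (ℤ × ℤ)) : SimpleGraph S where
  Adj a b := (a.1.1 - b.1.1) ^ 2 + (a.1.2 - b.1.2) ^ 2 = 1
  symm := ⟨fun a b hab => by rw [← hab]; ring⟩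
  loopless := ⟨fun a haa => by simp at haa⟩

/-- The vertex set `ℕ × {0, …, h - 1}` of the half-infinite strip of height `h`. -/
def strip (h : ℕ) : Set (ℤ × ℤ) := {q | 0 ≤ q.1 ∧ 0 ≤ q.2 ∧ q.2 < h}

/-- The top-left corner `(0, h - 1)` of the strip of height `h ≥ 1`. -/
def topLeft (h : ℕ) (hh : 1 ≤ h) : strip h :=
  ⟨(0, (h : ℤ) - 1), by simp only [strip, Set.mem_ofPred_eq]; omega⟩

/-- A growing self-avoiding walk on `G` with starting vertex `v`: a finite walk that visits no
vertex twice and whose endpoint is trapped, i.e. all neighbours of the endpoint are occupied. -/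
structure GSAW {V : Type*} (G : SimpleGraph V) (v : V) where
  endpoint : V
  walk : G.Walk v endpoint
  isPath : walk.IsPath
  trapped : ∀ w, G.Adj endpoint w → w ∈ walk.support

namespace GSAW

variable {V : Type*} {G : SimpleGraph V} {v : V}

/-- The number of edges. -/
def length (W : GSAW G v) : ℕ := W.walk.length

/-- The `i`-th vertex of the walk, `i = 0, …, W.length`. -/
def vertex (W : GSAW G v) (i : ℕ) : V := W.walk.getVert i

/-- The neighbours of the `i`-th vertex that are unoccupied when the walk consists of its
vertices `0, …, i`. -/
def openNeighbours (W : GSAW G v) (i : ℕ) : Set V :=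
  {u | G.Adj (W.vertex i) u ∧ ∀ j ≤ i, u ≠ W.vertex j}

/-- The probability of `W` under the uniform model: the product of the probabilities of its
steps, each step being uniform among the unoccupied neighbours of the current endpoint. -/
noncomputable def uniformProb (W : GSAW G v) : ℚ :=
  ∏ i ∈ Finset.range W.length, 1 / ((W.openNeighbours i).ncard : ℚ)

/-- The displacement of a GSAW on a grid graph: the difference between the largest and the
smallest `x`-coordinate of its vertices. -/
def displacement {S : Set (ℤ × ℤ)} {v : S} (W : GSAW (gridGraph S) v) : ℕ :=
  ((Finset.range (W.length + 1)).sup' Finset.nonempty_range_add_one (fun i => (W.vertex i).1.1) -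
    (Finset.range (W.length + 1)).inf' Finset.nonempty_range_add_one
      (fun i => (W.vertex i).1.1)).toNat

theorem ext_vertex (W W' : GSAW G v) (hl : W.length = W'.length)
    (hv : ∀ i ≤ W.length, W.vertex i = W'.vertex i) : W = W' := by
  obtain ⟨e, p, hp, ht⟩ := W
  obtain ⟨e', p', hp', ht'⟩ := W'
  have he : e = e' := by
    have := hv p.length le_rfl
    simp only [vertex, length] at this hl
    rw [p.getVert_length, hl, p'.getVert_length] at this
    exact this
  subst he
  have : p = p' := SimpleGraph.Walk.ext_getVert_le_length hl hv
  subst this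
  rfl

/-- The vertices of a walk on a grid graph are not far from its start. -/
theorem vertex_mem_box {S : Set (ℤ × ℤ)} {v : S} (W : GSAW (gridGraph S) v) (i : ℕ)
    (hi : i ≤ W.length) :
    (W.vertex i).1 ∈ Set.Icc (v.1.1 - i, v.1.2 - i) (v.1.1 + i, v.1.2 + i) := by
  induction i with
  | zero => simp [vertex]
  | succ i ih =>
    have h1 := ih (by omega)
    have h2 : (gridGraph S).Adj (W.vertex i) (W.vertex (i + 1)) :=
      W.walk.adj_getVert_succ (by simpa [length] using hi)
    simp only [gridGraph] at h2
    have aux : ∀ a b : ℤ, a ^ 2 + b ^ 2 = 1 → (-1 ≤ a ∧ a ≤ 1) ∧ (-1 ≤ b ∧ b ≤ 1) := by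
      intro a b hab
      refine ⟨⟨?_, ?_⟩, ?_, ?_⟩ <;> nlinarith [sq_nonneg a, sq_nonneg b]
    have h3 : (-1 ≤ (W.vertex i).1.1 - (W.vertex (i + 1)).1.1 ∧
        (W.vertex i).1.1 - (W.vertex (i + 1)).1.1 ≤ 1) ∧
        (-1 ≤ (W.vertex i).1.2 - (W.vertex (i + 1)).1.2 ∧
        (W.vertex i).1.2 - (W.vertex (i + 1)).1.2 ≤ 1) := aux _ _ h2
    simp only [Set.mem_Icc, Prod.le_def] at h1 ⊢
    push_cast
    omega

theorem finite_length_displacement {S : Set (ℤ × ℤ)} {v : S} (n k : ℕ) :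
    {W : GSAW (gridGraph S) v | W.length = n ∧ W.displacement = k}.Finite := by
  have hfin : (Set.univ.pi fun i : Fin (n + 1) =>
      Set.Icc (v.1.1 - (i : ℕ), v.1.2 - (i : ℕ)) (v.1.1 + (i : ℕ), v.1.2 + (i : ℕ))).Finite :=
    Set.Finite.pi fun i => Set.finite_Icc _ _
  refine Set.Finite.of_finite_image (f := fun W (i : Fin (n + 1)) => (W.vertex i).1)
    (hfin.subset ?_) ?_
  · rintro _ ⟨W, ⟨hW, -⟩, rfl⟩ i -
    exact W.vertex_mem_box i (by omega)
  · rintro W ⟨hW, -⟩ W' ⟨hW', -⟩ hWW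
    refine ext_vertex W W' (by omega) fun i hi => Subtype.ext ?_
    exact congrFun hWW (⟨i, by omega⟩ : Fin (n + 1))

end GSAW

/-- The generating function `∑_W p(W) x^|W| y^‖W‖` over all GSAWs on the grid graph on `S` with
starting vertex `v`, where `p` is the probability under the uniform model. It is a formal power
series in `x` (variable `0`) and `y` (variable `1`) whose coefficient at `x^n y^k` is the sum of
`p(W)` over the finitely many GSAWs `W` with length `n` and displacement `k`. -/
noncomputable def uniformGenFun (S : Set (ℤ × ℤ)) (v : S) : MvPowerSeries (Fin 2) ℚ :=
  fun e => ∑ W ∈ (GSAW.finite_length_displacement (v := v) (e 0) (e 1)).toFinset, W.uniformProb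

/-- A formal power series is rational if it is a quotient `P / Q` of two polynomials, the
denominator having non-zero constant term (so that it is invertible as a power series). -/
def IsRationalSeries {σ K : Type*} [Field K] (f : MvPowerSeries σ K) : Prop :=
  ∃ P Q : MvPolynomial σ K, MvPolynomial.constantCoeff Q ≠ 0 ∧
    (Q : MvPowerSeries σ K) * f = (P : MvPowerSeries σ K)

/-! This is a transfer-matrix argument. A walk is treated as the list of its vertices. The
unoccupied neighbours of a vertex `v` depend only on which neighbours precede `v` in the list
(`openSet`), so step probabilities and trapping are local: they are seen by any restriction of the
list to columns that contains the column of `v` and the two adjacent ones. The endpoint is the only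
vertex with an empty `openSet`, and `stepProb` is 1 there, so the probability of the walk is a
product over all its vertices.

For a column `c`, restrict the list to the columns up to `c + 1` and to those from `c` on. The
overlap of two columns makes this cut reversible: the restrictions determine the walk
(`amalgam_filter`), and conversely restrictions that agree on the overlap merge to a walk
(`isChain_amalgam`, `exists_splice`). In the left restriction consecutive vertices can be
non-adjacent only in column `c + 1`, in the right one only in column `c`; hence two consecutive
vertices of the merged list are adjacent. The possible right parts thus depend only on the word in
the two overlap columns and on whether the walk is trapped on the left. Up to translation there are
finitely many such states.

Let `G s` be the generating function of the right parts for the state `s`. Moving the cut by one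
column expresses `G s` as a polynomial plus a finite combination of the series `G s'`, where each
coefficient is a monomial divisible by `y` because a new column is reached. The matrix of the system
is the identity modulo terms without constant part, so Cramer's rule gives a common denominator with
constant term 1, and the full series is a finite polynomial combination of the `G s`. -/

/-! ### Merging words along two common levels -/

section Amalgam

variable {α : Type*}

/-- The amalgam of a word `L` of letters of height at most `d + 1` and a word `R` of letters of
height at least `d` along their common subword of letters of height `d` and `d + 1`. -/
def amalgam (f : α → ℤ) (d : ℤ) : List α → List α → List α
  | [], R => R
  | a :: L, [] => a :: L
  | a :: L, b :: R =>
    if f a < d then a :: amalgam f d L (b :: R)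
    else if d + 1 < f b then b :: amalgam f d (a :: L) R
    else a :: amalgam f d L R
termination_by L R => L.length + R.length

variable {f : α → ℤ} {d : ℤ}

theorem filter_amalgam (L R : List α) (hL : ∀ a ∈ L, f a ≤ d + 1) (hR : ∀ b ∈ R, d ≤ f b)
    (h : L.filter (d ≤ f ·) = R.filter (f · ≤ d + 1)) :
    (amalgam f d L R).filter (f · ≤ d + 1) = L ∧ (amalgam f d L R).filter (d ≤ f ·) = R := by
  induction L, R using amalgam.induct (f := f) (d := d) with
  | case1 R =>
    simp only [amalgam]
    exact ⟨h.symm, by simpa using hR⟩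
  | case2 a L =>
    simp only [amalgam]
    exact ⟨by simpa using hL, h⟩
  | case3 a L b R hlt ih =>
    simp only [amalgam, hlt, if_true]
    simp only [List.forall_mem_cons] at hL
    have h1 : ¬ d ≤ f a := by omega
    have h2 : f a ≤ d + 1 := by omega
    rw [List.filter_cons_of_neg (by simpa using h1)] at h
    have := ih hL.2 hR h
    rw [List.filter_cons_of_pos (by simpa using h2), List.filter_cons_of_neg (by simpa using h1)]
    exact ⟨by rw [this.1], this.2⟩
  | case4 a L b R hge hlt ih =>
    simp only [amalgam, hge, hlt, if_true, if_false]
    simp only [List.forall_mem_cons] at hR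
    have h1 : ¬ f b ≤ d + 1 := by omega
    rw [List.filter_cons_of_neg (a := b) (by simpa using h1)] at h
    have := ih hL hR.2 h
    rw [List.filter_cons_of_neg (a := b) (by simpa using h1),
      List.filter_cons_of_pos (a := b) (by simpa using hR.1)]
    exact ⟨this.1, by rw [this.2]⟩
  | case5 a L b R hge hle ih =>
    simp only [amalgam, hge, hle, if_false]
    simp only [List.forall_mem_cons] at hL hR
    rw [List.filter_cons_of_pos (by simpa using hge),
      List.filter_cons_of_pos (by simpa using hle), List.cons.injEq] at h
    have := ih hL.2 hR.2 h.2
    rw [List.filter_cons_of_pos (by simpa using hL.1),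
      List.filter_cons_of_pos (by simpa using hge)]
    exact ⟨by rw [this.1], by rw [this.2, h.1]⟩

variable {r : α → α → Prop}

/-- Here `p`, `q` and `z` are the letters last read from the left word, last read from the right
word and last written. By `hz`, either all three coincide in the overlap, or `z` is strictly left
and the right word waits at level `d`, or `z` is strictly right and the left word waits at level `d
+ 1`. Since `r` changes the level by at most 1, a waiting word resumes only when the other has come
back to the overlap. -/
theorem isChain_amalgam (hr : ∀ a b, r a b → f a ≤ f b + 1 ∧ f b ≤ f a + 1) (L R : List α)
    (hL : ∀ a ∈ L, f a ≤ d + 1) (hR : ∀ b ∈ R, d ≤ f b)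
    (h : L.filter (d ≤ f ·) = R.filter (f · ≤ d + 1)) (p q z : α)
    (hz : (p = z ∧ q = z ∧ d ≤ f z ∧ f z ≤ d + 1) ∨ (p = z ∧ f z < d ∧ f q = d) ∨
      (q = z ∧ d + 1 < f z ∧ f p = d + 1))
    (hcL : (p :: L).IsChain fun a b => r a b ∨ (f a = d + 1 ∧ f b = d + 1))
    (hcR : (q :: R).IsChain fun a b => r a b ∨ (f a = d ∧ f b = d)) :
    (z :: amalgam f d L R).IsChain r := by
  induction L, R using amalgam.induct (f := f) (d := d) generalizing p q z with
  | case1 R =>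
    simp only [amalgam]
    have hR' : ∀ b ∈ R, d + 1 < f b := by simpa using h.symm
    clear h hcL
    induction R generalizing q z p with
    | nil => simp
    | cons b R ih =>
      simp only [List.forall_mem_cons] at hR hR'
      rw [List.isChain_cons_cons] at hcR ⊢
      have hqb : r q b := by
        rcases hcR.1 with h | h
        · exact h
        · omega
      have := hr _ _ hqb
      have hzq : q = z ∧ d < f z := by
        rcases hz with h | h | h
        · refine ⟨h.2.1, ?_⟩
          have := h.2.1 ▸ this
          omega
        · omega
        · exact ⟨h.1, by omega⟩
      refine ⟨hzq.1 ▸ hqb, ?_⟩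
      have hstep : ∀ p' : α, f p' = d + 1 → (b :: R).IsChain r := fun p' hp' =>
        ih hR.2 p' b b (Or.inr (Or.inr ⟨rfl, hR'.1, hp'⟩)) hcR.2 hR'.2
      rcases hz with h | h | h
      · exact hstep z (by omega)
      · omega
      · exact hstep p h.2.2
  | case2 a L =>
    simp only [amalgam]
    have hL' : ∀ b ∈ a :: L, f b < d := by simpa using h
    clear h hcR
    generalize a :: L = L at *
    induction L generalizing q z p with
    | nil => simp
    | cons b R ih =>
      simp only [List.forall_mem_cons] at hL hL'
      rw [List.isChain_cons_cons] at hcL ⊢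
      have hqb : r p b := by
        rcases hcL.1 with h | h
        · exact h
        · omega
      have := hr _ _ hqb
      have hzq : p = z ∧ f z ≤ d := by
        rcases hz with h | h | h
        · refine ⟨h.1, ?_⟩
          have := h.1 ▸ this
          omega
        · exact ⟨h.1, by omega⟩
        · omega
      refine ⟨hzq.1 ▸ hqb, ?_⟩
      have hstep : ∀ p' : α, f p' = d → (b :: R).IsChain r := fun p' hp' =>
        ih b p' b (Or.inr (Or.inl ⟨rfl, hL'.1, hp'⟩)) hL.2 hcL.2 hL'.2
      rcases hz with h | h | h
      · exact hstep z (by omega)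
      · exact hstep q h.2.2
      · omega
  | case3 a L b R hlt ih =>
    simp only [amalgam, hlt, if_true]
    simp only [List.forall_mem_cons] at hL
    have h1 : ¬ d ≤ f a := by omega
    rw [List.filter_cons_of_neg (by simpa using h1)] at h
    rw [List.isChain_cons_cons] at hcL ⊢
    have hpa : r p a := by
      rcases hcL.1 with h | h
      · exact h
      · omega
    have hd := hr _ _ hpa
    have hq : p = z ∧ f q = d := by
      rcases hz with ⟨rfl, rfl, h3, h4⟩ | h | h
      · exact ⟨rfl, by omega⟩
      · exact ⟨h.1, h.2.2⟩
      · omega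
    exact ⟨hq.1 ▸ hpa, ih hL.2 hR h a q a (Or.inr (Or.inl ⟨rfl, hlt, hq.2⟩)) hcL.2 hcR⟩
  | case4 a L b R hge hlt ih =>
    simp only [amalgam, hge, hlt, if_true, if_false]
    simp only [List.forall_mem_cons] at hR
    have h1 : ¬ f b ≤ d + 1 := by omega
    rw [List.filter_cons_of_neg (a := b) (by simpa using h1)] at h
    rw [List.isChain_cons_cons] at hcR ⊢
    have hqb : r q b := by
      rcases hcR.1 with h | h
      · exact h
      · omega
    have hd := hr _ _ hqb
    have hp : q = z ∧ f p = d + 1 := by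
      rcases hz with ⟨rfl, rfl, h3, h4⟩ | h | h
      · exact ⟨rfl, by omega⟩
      · omega
      · exact ⟨h.1, h.2.2⟩
    exact ⟨hp.1 ▸ hqb, ih hL hR.2 h p b b (Or.inr (Or.inr ⟨rfl, hlt, hp.2⟩)) hcL hcR.2⟩
  | case5 a L b R hge hle ih =>
    simp only [amalgam, hge, hle, if_false]
    simp only [List.forall_mem_cons] at hL hR
    rw [List.filter_cons_of_pos (by simpa using hge),
      List.filter_cons_of_pos (by simpa using hle), List.cons.injEq] at h
    obtain ⟨rfl, h⟩ := h
    rw [List.isChain_cons_cons] at hcL hcR ⊢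
    refine ⟨?_, ih hL.2 hR.2 h a a a (Or.inl ⟨rfl, rfl, by omega, by omega⟩) hcL.2 hcR.2⟩
    rcases hz with ⟨rfl, rfl, h3, h4⟩ | ⟨rfl, h3, h4⟩ | ⟨rfl, h3, h4⟩
    -- A gap in the left word needs level `d + 1` at both ends, a gap in the right word level `d`;
    -- the same pair of letters cannot be a gap in both.
    · rcases hcL.1 with h5 | h5
      · exact h5
      · rcases hcR.1 with h6 | h6
        · exact h6
        · omega
    · rcases hcL.1 with h5 | h5
      · exact h5
      · omega
    · rcases hcR.1 with h5 | h5
      · exact h5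
      · omega

/-- An excursion above level `e` leaves from level `e` and returns to it. `p` is the last letter of
the full word and `q` the last one kept; during an excursion `q` has level `e`. -/
theorem filter_le_of_isChain (hr : ∀ a b, r a b → f a ≤ f b + 1 ∧ f b ≤ f a + 1) (e : ℤ) (p : α)
    (U : List α) (h : (p :: U).IsChain r) (q : α) (hq : (f p ≤ e ∧ q = p) ∨ (e < f p ∧ f q = e)) :
    (q :: U.filter (f · ≤ e)).IsChain fun a b => r a b ∨ (f a = e ∧ f b = e) := by
  induction U generalizing p q with
  | nil => simp
  | cons b U ih =>
    rw [List.isChain_cons_cons] at h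
    have hpb := hr _ _ h.1
    by_cases hb : f b ≤ e
    · rw [List.filter_cons_of_pos (by simpa using hb), List.isChain_cons_cons]
      refine ⟨?_, ih b h.2 b (Or.inl ⟨hb, rfl⟩)⟩
      rcases hq with ⟨h1, rfl⟩ | h1
      · exact Or.inl h.1
      · exact Or.inr (by omega)
    · rw [List.filter_cons_of_neg (by simpa using hb)]
      refine ih b h.2 q (Or.inr ⟨by omega, ?_⟩)
      rcases hq with ⟨h1, rfl⟩ | h1
      · omega
      · exact h1.2

theorem filter_ge_of_isChain (hr : ∀ a b, r a b → f a ≤ f b + 1 ∧ f b ≤ f a + 1) (e : ℤ) (p : α)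
    (U : List α) (h : (p :: U).IsChain r) (q : α) (hq : (e ≤ f p ∧ q = p) ∨ (f p < e ∧ f q = e)) :
    (q :: U.filter (e ≤ f ·)).IsChain fun a b => r a b ∨ (f a = e ∧ f b = e) := by
  have := filter_le_of_isChain (f := fun a => - f a) (r := r)
    (fun a b hab => by have := hr a b hab; omega) (-e) p U h q (by simpa using hq)
  simpa using this

/-- The order of the merge is forced: to pass between the levels below `d` and those above `d + 1`,
the word must use a letter of the overlap. -/
theorem amalgam_filter (hr : ∀ a b, r a b → f a ≤ f b + 1 ∧ f b ≤ f a + 1) (U : List α)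
    (h : U.IsChain r) :
    amalgam f d (U.filter (f · ≤ d + 1)) (U.filter (d ≤ f ·)) = U := by
  induction U with
  | nil => simp [amalgam]
  | cons u U ih =>
    replace ih := ih h.tail
    by_cases h1 : f u < d
    · rw [List.filter_cons_of_pos (by simp; omega), List.filter_cons_of_neg (by simpa using h1)]
      cases hR : U.filter (d ≤ f ·) with
      | nil =>
        simp only [amalgam]
        rw [List.filter_eq_self.2]
        intro a ha
        have := List.filter_eq_nil_iff.1 hR a ha
        simp only [decide_eq_true_eq] at this ⊢
        omega
      | cons b R => simp only [amalgam, h1, if_true]; rw [← hR, ih]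
    · by_cases h2 : d + 1 < f u
      · rw [List.filter_cons_of_neg (by simpa using h2),
          List.filter_cons_of_pos (by simpa using h1)]
        have hc := filter_le_of_isChain hr (d + 1) u U h
        cases hL : U.filter (f · ≤ d + 1) with
        | nil =>
          simp only [amalgam]
          rw [List.filter_eq_self.2]
          intro a ha
          have := List.filter_eq_nil_iff.1 hL a ha
          simp only [decide_eq_true_eq] at this ⊢
          omega
        | cons a L =>
          -- `a` is the first letter at level at most `d + 1` after one above it, so its level is
          -- exactly `d + 1`.
          have ha : ¬ f a < d := by
            clear ih
            induction U generalizing u with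
            | nil => simp at hL
            | cons b U ih =>
              rw [List.isChain_cons_cons] at h
              have hb := hr _ _ h.1
              by_cases hb2 : f b ≤ d + 1
              · rw [List.filter_cons_of_pos (by simpa using hb2)] at hL
                injection hL with h3 h4
                subst h3
                omega
              · rw [List.filter_cons_of_neg (by simpa using hb2)] at hL
                exact ih b h.2 (by omega) (by omega) (filter_le_of_isChain hr (d + 1) b U h.2) hL
          simp only [amalgam, ha, h2, if_false, if_true]
          rw [← hL, ih]
      · rw [List.filter_cons_of_pos (by simpa using h2),
          List.filter_cons_of_pos (by simpa using h1)]
        simp only [amalgam, h1, h2, if_false]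
        rw [ih]

end Amalgam

/-! ### Generating functions of weighted sets -/

section WeightSeries

variable {σ K ι : Type*} [Field K]

/-- The generating function `∑_{i ∈ s} w i X^(deg i)`; it is meaningful if only finitely many
elements of `s` have a given degree. -/
noncomputable def weightSeries (s : Set ι) (w : ι → K) (deg : ι → σ →₀ ℕ) : MvPowerSeries σ K :=
  fun e => ∑ᶠ i ∈ {i | i ∈ s ∧ deg i = e}, w i

theorem coeff_weightSeries (s : Set ι) (w : ι → K) (deg : ι → σ →₀ ℕ) (e : σ →₀ ℕ) :
    MvPowerSeries.coeff e (weightSeries s w deg) = ∑ᶠ i ∈ {i | i ∈ s ∧ deg i = e}, w i := rfl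

theorem weightSeries_eq_of_bijOn {κ : Type*} {s : Set ι} {t : Set κ} {w : ι → K} {w' : κ → K}
    {deg : ι → σ →₀ ℕ} {deg' : κ → σ →₀ ℕ} (φ : ι → κ) (hφ : s.BijOn φ t)
    (hw : ∀ i ∈ s, w i = w' (φ i)) (hdeg : ∀ i ∈ s, deg i = deg' (φ i)) :
    weightSeries s w deg = weightSeries t w' deg' := by
  ext e
  rw [coeff_weightSeries, coeff_weightSeries]
  refine finsum_mem_eq_of_bijOn φ ⟨?_, ?_, ?_⟩ fun i hi => hw i hi.1
  · exact fun i hi => ⟨hφ.mapsTo hi.1, by rw [← hdeg i hi.1]; exact hi.2⟩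
  · exact hφ.injOn.mono fun i hi => hi.1
  · rintro k ⟨hk, hke⟩
    obtain ⟨i, hi, rfl⟩ := hφ.surjOn hk
    exact ⟨i, ⟨hi, by rw [hdeg i hi]; exact hke⟩, rfl⟩

theorem weightSeries_shift {s : Set ι} {w w' : ι → K} {deg deg' : ι → σ →₀ ℕ} (a : K)
    (m : σ →₀ ℕ) (hw : ∀ i ∈ s, w i = a * w' i) (hdeg : ∀ i ∈ s, deg i = m + deg' i) :
    weightSeries s w deg = MvPowerSeries.monomial m a * weightSeries s w' deg' := by
  classical
  ext e
  rw [MvPowerSeries.coeff_monomial_mul]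
  split_ifs with hme
  · rw [coeff_weightSeries, coeff_weightSeries, mul_finsum_mem]
    refine finsum_mem_congr ?_ fun i hi => hw i hi.1
    ext i
    refine and_congr_right fun hi => ?_
    rw [hdeg i hi, eq_tsub_iff_add_eq_of_le hme, add_comm]
  · rw [coeff_weightSeries]
    have : {i | i ∈ s ∧ deg i = e} = ∅ := by
      ext i
      simp only [Set.mem_ofPred_eq, Set.mem_empty_iff_false, iff_false, not_and]
      rintro hi rfl
      exact hme (by rw [hdeg i hi]; exact le_self_add)
    rw [this, finsum_mem_empty]

theorem weightSeries_of_finite {s : Set ι} (hs : s.Finite) (w : ι → K) (deg : ι → σ →₀ ℕ) :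
    ∃ P : MvPolynomial σ K, weightSeries s w deg = (P : MvPowerSeries σ K) := by
  classical
  refine ⟨∑ i ∈ hs.toFinset, MvPolynomial.monomial (deg i) (w i), ?_⟩
  ext e
  rw [coeff_weightSeries, MvPolynomial.coeff_coe, MvPolynomial.coeff_sum]
  simp only [MvPolynomial.coeff_monomial]
  rw [← Finset.sum_filter, ← finsum_mem_finset_eq_sum]
  congr 1
  ext i
  simp

theorem weightSeries_union {s t : Set ι} (hst : Disjoint s t) (w : ι → K) (deg : ι → σ →₀ ℕ)
    (hs : ∀ e, {i | i ∈ s ∧ deg i = e}.Finite) (ht : ∀ e, {i | i ∈ t ∧ deg i = e}.Finite) :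
    weightSeries (s ∪ t) w deg = weightSeries s w deg + weightSeries t w deg := by
  ext e
  rw [map_add, coeff_weightSeries, coeff_weightSeries, coeff_weightSeries,
    ← finsum_mem_union _ (hs e) (ht e)]
  · congr 1
    ext i
    simp [or_and_right]
  · exact hst.mono (fun i hi => hi.1) fun i hi => hi.1

theorem weightSeries_biUnion {κ : Type*} (T : Finset κ) {t : κ → Set ι}
    (hT : (T : Set κ).PairwiseDisjoint t) (w : ι → K) (deg : ι → σ →₀ ℕ)
    (ht : ∀ k ∈ T, ∀ e, {i | i ∈ t k ∧ deg i = e}.Finite) :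
    weightSeries (⋃ k ∈ T, t k) w deg = ∑ k ∈ T, weightSeries (t k) w deg := by
  ext e
  rw [map_sum, coeff_weightSeries, ← finsum_mem_finset_eq_sum]
  simp only [coeff_weightSeries]
  have := finsum_mem_biUnion (f := w) (I := (T : Set κ)) (t := fun k => {i | i ∈ t k ∧ deg i = e})
    (fun a ha b hb hab => (hT ha hb hab).mono (fun i hi => hi.1) fun i hi => hi.1)
    T.finite_toSet fun k hk => ht k hk e
  simp only [Finset.mem_coe] at this
  rw [← this]
  refine finsum_mem_congr ?_ fun _ _ => rfl
  ext i
  simp only [Set.mem_ofPred_eq, Set.mem_iUnion, exists_and_right, exists_prop]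

end WeightSeries

/-! ### Contracting linear systems of power series -/

section LinearSystem

variable {σ K ι : Type*} [Field K] [Fintype ι]

/-- A power series is affine over a family `G` if it is an affine combination of the members
of `G` whose coefficients are polynomials, those of the `G i` having constant term `0`. -/
def IsAffineOver (G : ι → MvPowerSeries σ K) (g : MvPowerSeries σ K) : Prop :=
  ∃ (b : MvPolynomial σ K) (m : ι → MvPolynomial σ K), (∀ i, MvPolynomial.constantCoeff (m i) = 0) ∧
    g = (b : MvPowerSeries σ K) + ∑ i, (m i : MvPowerSeries σ K) * G i

variable {G : ι → MvPowerSeries σ K}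

theorem IsAffineOver.add {g g' : MvPowerSeries σ K} (h : IsAffineOver G g)
    (h' : IsAffineOver G g') : IsAffineOver G (g + g') := by
  obtain ⟨b, m, hm, rfl⟩ := h
  obtain ⟨b', m', hm', rfl⟩ := h'
  refine ⟨b + b', fun i => m i + m' i, fun i => by rw [map_add, hm, hm', add_zero], ?_⟩
  simp only [MvPolynomial.coe_add, add_mul, Finset.sum_add_distrib]
  ring

theorem isAffineOver_coe (b : MvPolynomial σ K) : IsAffineOver G (b : MvPowerSeries σ K) :=
  ⟨b, 0, fun i => by simp, by simp⟩

theorem isAffineOver_coe_mul (i : ι) (m : MvPolynomial σ K)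
    (hm : MvPolynomial.constantCoeff m = 0) : IsAffineOver G ((m : MvPowerSeries σ K) * G i) := by
  classical
  refine ⟨0, Pi.single i m, fun j => ?_, ?_⟩
  · rcases eq_or_ne j i with rfl | h
    · simpa using hm
    · simp [h]
  · rw [Finset.sum_eq_single i]
    · simp
    · intro j _ h
      simp [h]
    · simp

theorem isAffineOver_sum {κ : Type*} (T : Finset κ) (g : κ → MvPowerSeries σ K)
    (h : ∀ k ∈ T, IsAffineOver G (g k)) : IsAffineOver G (∑ k ∈ T, g k) :=
  Finset.sum_induction g (IsAffineOver G) (fun _ _ => IsAffineOver.add)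
    (by simpa using isAffineOver_coe (G := G) 0) h

/-- Cramer's rule: the solution of a contracting linear system is rational, with a common
denominator. -/
theorem exists_common_denominator (h : ∀ i, IsAffineOver G (G i)) :
    ∃ Q : MvPolynomial σ K, MvPolynomial.constantCoeff Q ≠ 0 ∧
      ∀ i, ∃ P : MvPolynomial σ K, (Q : MvPowerSeries σ K) * G i = (P : MvPowerSeries σ K) := by
  classical
  choose b m hm hG using h
  let c : MvPolynomial σ K →+* MvPowerSeries σ K := MvPolynomial.coeToMvPowerSeries.ringHom
  have hc : ∀ p, c p = (p : MvPowerSeries σ K) := fun p => rfl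
  let A : Matrix ι ι (MvPolynomial σ K) := 1 - Matrix.of m
  have hA : (A.map c).mulVec G = fun i => c (b i) := by
    have h1 : A.map c = 1 - (Matrix.of m).map c := by
      ext i j : 1
      by_cases hij : i = j <;> simp [A, hij]
    rw [h1, Matrix.sub_mulVec, Matrix.one_mulVec]
    ext i : 1
    rw [Pi.sub_apply, sub_eq_iff_eq_add, hc]
    exact hG i
  refine ⟨A.det, ?_, fun i => ⟨(A.adjugate.mulVec b) i, ?_⟩⟩
  · rw [RingHom.map_det]
    have : MvPolynomial.constantCoeff.mapMatrix A = (1 : Matrix ι ι K) := by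
      ext i j
      rcases eq_or_ne i j with rfl | hij <;> simp_all [A]
    rw [this, Matrix.det_one]
    exact one_ne_zero
  · have h2 : (A.map c).adjugate.mulVec ((A.map c).mulVec G) = (A.map c).det • G := by
      rw [Matrix.mulVec_mulVec, Matrix.adjugate_mul, Matrix.smul_mulVec, Matrix.one_mulVec]
    have h3 := congrFun h2 i
    rw [hA] at h3
    have h4 : (A.map c).det = c A.det := (RingHom.map_det c A).symm
    have h5 : (A.map c).adjugate = A.adjugate.map c := (RingHom.map_adjugate c A).symm
    rw [h4, h5, Pi.smul_apply, smul_eq_mul, hc] at h3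
    rw [← h3, ← hc, RingHom.map_mulVec]
    rfl

theorem isRationalSeries_of_isAffineOver {g : MvPowerSeries σ K}
    (h : ∀ i, IsAffineOver G (G i)) (κ : Type*) (T : Finset κ) (m : κ → MvPolynomial σ K)
    (τ : κ → ι) (hg : g = ∑ k ∈ T, (m k : MvPowerSeries σ K) * G (τ k)) : IsRationalSeries g := by
  obtain ⟨Q, hQ, hP⟩ := exists_common_denominator h
  choose P hP using hP
  refine ⟨∑ k ∈ T, m k * P (τ k), Q, hQ, ?_⟩
  let c : MvPolynomial σ K →+* MvPowerSeries σ K := MvPolynomial.coeToMvPowerSeries.ringHom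
  have hc : ∀ p : MvPolynomial σ K, (p : MvPowerSeries σ K) = c p := fun p => rfl
  simp only [hc] at hP hg ⊢
  rw [hg, Finset.mul_sum, map_sum]
  refine Finset.sum_congr rfl fun k _ => ?_
  rw [map_mul, ← hP, mul_left_comm]

end LinearSystem

/-! ### Locality of open neighbours, cutting and splicing walks -/

section Lattice

/-- Two points of `ℤ × ℤ` are adjacent if their Euclidean distance is `1`. -/
def latticeAdj (a b : ℤ × ℤ) : Prop := (a.1 - b.1) ^ 2 + (a.2 - b.2) ^ 2 = 1

theorem latticeAdj.bounds {a b : ℤ × ℤ} (h : latticeAdj a b) :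
    (a.1 ≤ b.1 + 1 ∧ b.1 ≤ a.1 + 1) ∧ (a.2 ≤ b.2 + 1 ∧ b.2 ≤ a.2 + 1) := by
  have aux : ∀ a b : ℤ, a ^ 2 + b ^ 2 = 1 → (-1 ≤ a ∧ a ≤ 1) ∧ (-1 ≤ b ∧ b ≤ 1) := by
    intro a b hab
    refine ⟨⟨?_, ?_⟩, ?_, ?_⟩ <;> nlinarith [sq_nonneg a, sq_nonneg b]
  have := aux _ _ h
  omega

theorem latticeAdj.fst_bounds (a b : ℤ × ℤ) (h : latticeAdj a b) :
    a.1 ≤ b.1 + 1 ∧ b.1 ≤ a.1 + 1 :=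
  h.bounds.1

/-- Horizontal translation by `t`. -/
def hshift (t : ℤ) (v : ℤ × ℤ) : ℤ × ℤ := (v.1 + t, v.2)

@[simp] theorem hshift_fst (t : ℤ) (v : ℤ × ℤ) : (hshift t v).1 = v.1 + t := rfl

@[simp] theorem hshift_snd (t : ℤ) (v : ℤ × ℤ) : (hshift t v).2 = v.2 := rfl

theorem hshift_injective (t : ℤ) : Function.Injective (hshift t) := fun v w h => by
  have h1 := congrArg Prod.fst h
  have h2 := congrArg Prod.snd h
  simp only [hshift_fst, hshift_snd] at h1 h2
  exact Prod.ext (by omega) h2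

@[simp] theorem hshift_hshift (s t : ℤ) (v : ℤ × ℤ) : hshift s (hshift t v) = hshift (t + s) v :=
  Prod.ext (by simp [add_assoc]) rfl

@[simp] theorem hshift_zero : hshift 0 = id := funext fun v => Prod.ext (by simp) rfl

@[simp] theorem latticeAdj_hshift (t : ℤ) (v w : ℤ × ℤ) :
    latticeAdj (hshift t v) (hshift t w) ↔ latticeAdj v w := by
  simp [latticeAdj]

/-- Expressing "`u` precedes `v`" as a two-letter sublist makes it insensitive to deleting other
letters. -/
theorem pair_sublist_filter {α : Type*} {p : α → Bool} {l : List α} {u v : α} (hu : p u)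
    (hv : p v) : [u, v].Sublist (l.filter p) ↔ [u, v].Sublist l :=
  ⟨fun h => h.trans List.filter_sublist, fun h => by simpa [hu, hv] using h.filter p⟩

/-- The neighbours of `v` in the strip that do not precede `v` in the list `l`. -/
def openSet (h : ℕ) (l : List (ℤ × ℤ)) (v : ℤ × ℤ) : Set (ℤ × ℤ) :=
  {u | u ∈ strip h ∧ latticeAdj v u ∧ ¬ [u, v].Sublist l}

theorem openSet_filter (h : ℕ) (l : List (ℤ × ℤ)) (v : ℤ × ℤ) (p : ℤ × ℤ → Bool) (hv : p v)
    (hp : ∀ u, latticeAdj v u → p u) : openSet h (l.filter p) v = openSet h l v := by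
  ext u
  refine and_congr_right fun _ => and_congr_right fun hu => ?_
  rw [pair_sublist_filter (hp u hu) hv]

/-- The probability of the step leaving `v`, to be `1` if there is no such step. -/
noncomputable def stepProb (h : ℕ) (l : List (ℤ × ℤ)) (v : ℤ × ℤ) : ℚ :=
  open Classical in if openSet h l v = ∅ then 1 else 1 / ((openSet h l v).ncard : ℚ)

/-- The list `l` is the vertex list of a trapped self-avoiding walk on the strip of height `h`
starting at the top-left corner. -/
structure IsTrappedWalk (h : ℕ) (l : List (ℤ × ℤ)) : Prop where
  head : l.head? = some (0, (h : ℤ) - 1)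
  chain : l.IsChain latticeAdj
  nodup : l.Nodup
  mem_strip : ∀ v ∈ l, v ∈ strip h
  trapped : ∃ v ∈ l, openSet h l v = ∅

/-- The part of the list in the columns up to `c + 1`. -/
def leftPart (c : ℕ) (l : List (ℤ × ℤ)) : List (ℤ × ℤ) := l.filter (·.1 ≤ (c : ℤ) + 1)

/-- The part of the list in the columns from `c` on. -/
def rightPart (c : ℕ) (l : List (ℤ × ℤ)) : List (ℤ × ℤ) := l.filter ((c : ℤ) ≤ ·.1)

/-- The part of the list in the columns `c` and `c + 1`, moved to the columns `0` and `1`. -/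
def window (c : ℕ) (l : List (ℤ × ℤ)) : List (ℤ × ℤ) :=
  ((leftPart c l).filter ((c : ℤ) ≤ ·.1)).map (hshift (-c))

/-- The walk is trapped at a vertex in one of the columns up to `c`. -/
def TrappedLeft (h c : ℕ) (l : List (ℤ × ℤ)) : Prop := ∃ v ∈ l, v.1 ≤ c ∧ openSet h l v = ∅

/-- The walk is trapped at a vertex in one of the columns after `c`. -/
def TrappedRight (h c : ℕ) (l : List (ℤ × ℤ)) : Prop := ∃ v ∈ l, c < v.1 ∧ openSet h l v = ∅

/-- The part of `l` from column `c` on is a translate of the part of `u` from column `d` on. -/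
def SameRight (c d : ℕ) (l u : List (ℤ × ℤ)) : Prop :=
  (rightPart c l).map (hshift (d - c)) = rightPart d u

theorem SameRight.symm {c d : ℕ} {l u : List (ℤ × ℤ)} (hs : SameRight c d l u) :
    SameRight d c u l := by
  rw [SameRight, ← hs, List.map_map]
  convert List.map_id _
  funext v
  simp

theorem openSet_leftPart {h c : ℕ} (l : List (ℤ × ℤ)) {v : ℤ × ℤ} (hv : v.1 ≤ c) :
    openSet h (leftPart c l) v = openSet h l v :=
  openSet_filter _ _ _ _ (by simp; omega) fun u hu => by
    have := hu.fst_bounds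
    simp
    omega

theorem openSet_rightPart {h c : ℕ} (l : List (ℤ × ℤ)) {v : ℤ × ℤ} (hv : c < v.1) :
    openSet h (rightPart c l) v = openSet h l v :=
  openSet_filter _ _ _ _ (by simp; omega) fun u hu => by
    have := hu.fst_bounds
    simp
    omega

/-- Both positivity hypotheses keep the neighbours of the vertex within non-negative columns, so
that the left border of the strip plays no role. -/
theorem openSet_map_hshift (h : ℕ) (t : ℤ) (l : List (ℤ × ℤ)) {v : ℤ × ℤ} (hv : 0 < v.1)
    (hv' : 0 < v.1 + t) :
    openSet h (l.map (hshift t)) (hshift t v) = hshift t '' openSet h l v := by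
  have key : ∀ u, hshift t u ∈ openSet h (l.map (hshift t)) (hshift t v) ↔ u ∈ openSet h l v := by
    intro u
    simp only [openSet, Set.mem_ofPred_eq, latticeAdj_hshift, strip, hshift_fst, hshift_snd]
    have h1 : [hshift t u, hshift t v].Sublist (l.map (hshift t)) ↔ [u, v].Sublist l := by
      refine ⟨fun hsub => ?_, fun hsub => hsub.map _⟩
      have := hsub.map (hshift (-t))
      simpa [List.map_map, Function.comp_def] using this
    rw [h1]
    constructor
    · rintro ⟨h1, h2, h3⟩
      have := h2.fst_bounds
      exact ⟨⟨by omega, h1.2⟩, h2, h3⟩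
    · rintro ⟨h1, h2, h3⟩
      have := h2.fst_bounds
      exact ⟨⟨by omega, h1.2⟩, h2, h3⟩
  ext u
  constructor
  · intro hu
    refine ⟨hshift (-t) u, (key _).1 ?_, ?_⟩
    · simpa using hu
    · simp
  · rintro ⟨u, hu, rfl⟩
    exact (key u).2 hu

theorem SameRight.openSet_eq {h c d : ℕ} {l u : List (ℤ × ℤ)} (hs : SameRight c d l u)
    {v : ℤ × ℤ} (hv : c < v.1) :
    openSet h u (hshift (d - c) v) = hshift (d - c) '' openSet h l v := by
  rw [← openSet_rightPart (c := d) u (by simp; omega), ← hs,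
    openSet_map_hshift h _ _ (by omega) (by omega), openSet_rightPart l hv]

theorem SameRight.stepProb_eq {h c d : ℕ} {l u : List (ℤ × ℤ)} (hs : SameRight c d l u)
    {v : ℤ × ℤ} (hv : c < v.1) : stepProb h u (hshift (d - c) v) = stepProb h l v := by
  simp only [stepProb, hs.openSet_eq hv, Set.image_eq_empty,
    Set.ncard_image_of_injective _ (hshift_injective _)]

theorem SameRight.mem_of_mem {c d : ℕ} {l u : List (ℤ × ℤ)} (hs : SameRight c d l u)
    {v : ℤ × ℤ} (hv : v ∈ l) (hcv : c ≤ v.1) : hshift (d - c) v ∈ u := by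
  have : hshift (d - c) v ∈ rightPart d u := by
    rw [← hs]
    exact List.mem_map_of_mem (by simpa [rightPart] using ⟨hv, hcv⟩)
  exact List.mem_of_mem_filter this

theorem SameRight.trappedRight {h c d : ℕ} {l u : List (ℤ × ℤ)} (hs : SameRight c d l u)
    (ht : TrappedRight h c l) : TrappedRight h d u := by
  obtain ⟨v, hv, hcv, hopen⟩ := ht
  exact ⟨_, hs.mem_of_mem hv hcv.le, by simp; omega, by simp [hs.openSet_eq hcv, hopen]⟩

theorem trappedLeft_of_leftPart_eq {h c : ℕ} {l u : List (ℤ × ℤ)} (hs : leftPart c l = leftPart c u)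
    (ht : TrappedLeft h c l) : TrappedLeft h c u := by
  obtain ⟨v, hv, hcv, hopen⟩ := ht
  refine ⟨v, ?_, hcv, ?_⟩
  · have : v ∈ leftPart c l := by simp [leftPart, hv]; omega
    rw [hs] at this
    exact List.mem_of_mem_filter this
  · rw [← openSet_leftPart u hcv, ← hs, openSet_leftPart l hcv, hopen]

theorem IsTrappedWalk.trappedLeft_or_trappedRight {h : ℕ} {l : List (ℤ × ℤ)}
    (hl : IsTrappedWalk h l) (c : ℕ) : TrappedLeft h c l ∨ TrappedRight h c l := by
  obtain ⟨v, hv, hopen⟩ := hl.trapped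
  rcases le_or_gt v.1 c with hc | hc
  · exact Or.inl ⟨v, hv, hc, hopen⟩
  · exact Or.inr ⟨v, hv, hc, hopen⟩

theorem IsTrappedWalk.eq_of_parts {h c : ℕ} {l u : List (ℤ × ℤ)} (hl : IsTrappedWalk h l)
    (hu : IsTrappedWalk h u) (h1 : leftPart c l = leftPart c u)
    (h2 : rightPart c l = rightPart c u) : l = u := by
  rw [← amalgam_filter (f := Prod.fst) (d := c) latticeAdj.fst_bounds l hl.chain,
    ← amalgam_filter (f := Prod.fst) (d := c) latticeAdj.fst_bounds u hu.chain]
  simp only [leftPart, rightPart] at h1 h2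
  rw [h1, h2]

theorem IsTrappedWalk.chain_cons {h : ℕ} {l : List (ℤ × ℤ)} (hl : IsTrappedWalk h l) :
    ((-1, (h : ℤ) - 1) :: l).IsChain latticeAdj := by
  obtain _ | ⟨a, l⟩ := l
  · simp
  · have h1 := hl.head
    simp only [List.head?_cons, Option.some.injEq] at h1
    rw [List.isChain_cons_cons]
    exact ⟨by simp [h1, latticeAdj], hl.chain⟩

/-- The left part of a walk `m` and a translate of the right part of a walk `l` that induce the
same word at the interface can be spliced to a walk. -/
theorem exists_splice {h c d : ℕ} {l m : List (ℤ × ℤ)} (hl : IsTrappedWalk h l)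
    (hm : IsTrappedWalk h m) (hw : window c l = window d m)
    (ht : TrappedLeft h c l ↔ TrappedLeft h d m) :
    ∃ u, IsTrappedWalk h u ∧ leftPart d u = leftPart d m ∧ SameRight c d l u := by
  set l' := l.map (hshift (d - c)) with hl'
  have hright : (rightPart c l).map (hshift (d - c)) = rightPart d l' := by
    rw [rightPart, rightPart, hl', List.filter_map]
    congr 2
    funext v
    simp [add_sub_left_comm]
  have hwin : (leftPart d m).filter ((d : ℤ) ≤ ·.1) =
      (rightPart d l').filter (·.1 ≤ (d : ℤ) + 1) := by
    have h1 := congrArg (List.map (hshift d)) hw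
    simp only [window, List.map_map] at h1
    have h2 : hshift d ∘ hshift (-d) = id := funext fun v => by simp
    have h3 : hshift d ∘ hshift (-c) = hshift (d - c) := funext fun v => by
      simp [neg_add_eq_sub]
    rw [h2, h3, List.map_id] at h1
    rw [← h1, ← hright, List.filter_map, leftPart, rightPart, List.filter_filter,
      List.filter_filter]
    congr 2
    funext v
    have h4 : (v.1 + ((d : ℤ) - c) ≤ d + 1) ↔ v.1 ≤ c + 1 := by omega
    simp [h4, Bool.and_comm]
  have hchain' : (hshift (d - c) (-1, (h : ℤ) - 1) :: l').IsChain latticeAdj := by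
    rw [hl', ← List.map_cons, List.isChain_map]
    simpa using hl.chain_cons
  have hmL : ∀ a ∈ leftPart d m, a.1 ≤ (d : ℤ) + 1 := fun a ha => by
    simpa using (List.mem_filter.1 ha).2
  have hlR : ∀ a ∈ rightPart d l', (d : ℤ) ≤ a.1 := fun a ha => by
    simpa using (List.mem_filter.1 ha).2
  set u := amalgam Prod.fst d (leftPart d m) (rightPart d l') with hu
  -- A fictitious vertex left of the start puts the merge in its strictly left state. `(d, 0)` is an
  -- arbitrary point of column `d`, used as the waiting letter of the right word, where jumps within
  -- column `d` are allowed.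
  have hchain : ((-1, (h : ℤ) - 1) :: u).IsChain latticeAdj := by
    refine isChain_amalgam latticeAdj.fst_bounds _ _ hmL hlR hwin (-1, (h : ℤ) - 1)
      ((d : ℤ), 0) _ (Or.inr (Or.inl ⟨rfl, by simp; omega, rfl⟩)) ?_ ?_
    · exact filter_le_of_isChain latticeAdj.fst_bounds _ _ _ hm.chain_cons _
        (Or.inl ⟨by simp; omega, rfl⟩)
    · exact filter_ge_of_isChain latticeAdj.fst_bounds _ _ _ hchain' _
        (Or.inr ⟨by simp; omega, rfl⟩)
  obtain ⟨huL, huR⟩ := filter_amalgam (f := Prod.fst) (d := d) _ _ hmL hlR hwin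
  rw [← hu] at huL huR
  have hs : SameRight c d l u := hright.trans huR.symm
  have huL' : leftPart d u = leftPart d m := huL
  have hcases : ∀ v ∈ u, v ∈ leftPart d u ∨ v ∈ rightPart d u := by
    intro v hv
    simp only [leftPart, rightPart, List.mem_filter, hv, true_and, decide_eq_true_eq]
    omega
  refine ⟨u, ⟨?_, hchain.tail, ?_, ?_, ?_⟩, huL', hs⟩
  · have hhead := hm.head
    obtain _ | ⟨a, m'⟩ := m
    · simp at hhead
    · simp only [List.head?_cons, Option.some.injEq] at hhead
      subst hhead
      clear_value u
      obtain _ | ⟨b, u'⟩ := u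
      · rw [leftPart, leftPart, List.filter_cons_of_pos (by simp; omega)] at huL'
        simp at huL'
      -- The first vertex of `u` is adjacent to the fictitious one in column `-1`, so it lies in the
      -- left part and is the start of `m`.
      · rw [List.isChain_cons_cons] at hchain
        have hb := hchain.1.fst_bounds
        simp only at hb
        rw [leftPart, leftPart, List.filter_cons_of_pos (by simp; omega),
          List.filter_cons_of_pos (by simp; omega)] at huL'
        injection huL' with h1 h2
        rw [h1, List.head?_cons]
  · rw [List.nodup_iff_count_le_one]
    intro v
    by_cases hv : v.1 ≤ (d : ℤ) + 1
    · rw [← List.count_filter (p := fun v => v.1 ≤ (d : ℤ) + 1) (by simpa using hv), huL]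
      exact List.nodup_iff_count_le_one.1 (hm.nodup.filter _) v
    · rw [← List.count_filter (p := fun v => (d : ℤ) ≤ v.1) (by simp; omega), huR]
      exact List.nodup_iff_count_le_one.1
        ((hl.nodup.map (hshift_injective _)).filter _) v
  · intro v hv
    rcases hcases v hv with h1 | h1
    · rw [huL'] at h1
      exact hm.mem_strip v (List.mem_of_mem_filter h1)
    · rw [← hs, List.mem_map] at h1
      obtain ⟨w, hw, rfl⟩ := h1
      rw [rightPart, List.mem_filter] at hw
      have h2 := hl.mem_strip w hw.1
      have h3 : (c : ℤ) ≤ w.1 := by simpa using hw.2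
      exact ⟨by simp; omega, h2.2⟩
  -- The trapped vertex of `m` may be cut off. Then that of `l` either survives in the right part or
  -- lies on the left, and in the latter case `ht` provides one in the left part of `m`.
  · rcases hm.trappedLeft_or_trappedRight d with h1 | h1
    · obtain ⟨v, hv, -, h2⟩ := trappedLeft_of_leftPart_eq huL'.symm h1
      exact ⟨v, hv, h2⟩
    · rcases hl.trappedLeft_or_trappedRight c with h2 | h2
      · obtain ⟨v, hv, -, h2⟩ := trappedLeft_of_leftPart_eq huL'.symm (ht.1 h2)
        exact ⟨v, hv, h2⟩
      · obtain ⟨v, hv, -, h2⟩ := hs.trappedRight h2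
        exact ⟨v, hv, h2⟩

end Lattice

/-! ### The transfer recursion between interface states -/

section Transfer

/-- The product of the step probabilities at the vertices after column `c`. -/
noncomputable def probRight (h c : ℕ) (l : List (ℤ × ℤ)) : ℚ :=
  ∏ v ∈ l.toFinset with (c : ℤ) < v.1, stepProb h l v

/-- The number of vertices after column `c`. -/
def cardRight (c : ℕ) (l : List (ℤ × ℤ)) : ℕ := {v ∈ l.toFinset | (c : ℤ) < v.1}.card

/-- The largest `x`-coordinate of a list of points with non-negative `x`-coordinates. -/
def maxFst (l : List (ℤ × ℤ)) : ℕ := l.toFinset.sup fun v => v.1.toNat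

/-- The exponents of `x` and `y` contributed by the columns after column `c`. -/
noncomputable def degRight (c : ℕ) (l : List (ℤ × ℤ)) : Fin 2 →₀ ℕ :=
  Finsupp.single 0 (cardRight c l) + Finsupp.single 1 (maxFst l - c)

theorem maxFst_le_iff {l : List (ℤ × ℤ)} {n : ℕ} : maxFst l ≤ n ↔ ∀ v ∈ l, v.1 ≤ n := by
  simp [maxFst, Finset.sup_le_iff]

section SameRight

variable {c d : ℕ} {l u : List (ℤ × ℤ)}

theorem SameRight.maxFst_le (hs : SameRight c d l u) (k : ℕ) (hu : maxFst u ≤ d + k) :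
    maxFst l ≤ c + k := by
  rw [maxFst_le_iff] at hu ⊢
  intro v hv
  by_cases hcv : (c : ℤ) ≤ v.1
  · have := hu _ (hs.mem_of_mem hv hcv)
    simp only [hshift_fst] at this
    push_cast at this ⊢
    omega
  · push_cast
    omega

theorem SameRight.maxFst_sub_eq (hs : SameRight c d l u) : maxFst l - c = maxFst u - d := by
  have h1 := hs.maxFst_le (maxFst u - d) (by omega)
  have h2 := hs.symm.maxFst_le (maxFst l - c) (by omega)
  omega

theorem SameRight.image_eq (hs : SameRight c d l u) :
    {v ∈ l.toFinset | (c : ℤ) < v.1}.image (hshift (d - c)) =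
      {v ∈ u.toFinset | (d : ℤ) < v.1} := by
  ext w
  simp only [Finset.mem_image, Finset.mem_filter, List.mem_toFinset]
  constructor
  · rintro ⟨v, ⟨hv, hcv⟩, rfl⟩
    exact ⟨hs.mem_of_mem hv hcv.le, by simp; omega⟩
  · rintro ⟨hw, hdw⟩
    exact ⟨_, ⟨hs.symm.mem_of_mem hw hdw.le, by simp; omega⟩, by simp⟩

theorem SameRight.cardRight_eq (hs : SameRight c d l u) : cardRight c l = cardRight d u := by
  rw [cardRight, cardRight, ← hs.image_eq, Finset.card_image_of_injective _ (hshift_injective _)]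

theorem SameRight.degRight_eq (hs : SameRight c d l u) : degRight c l = degRight d u := by
  rw [degRight, degRight, hs.cardRight_eq, hs.maxFst_sub_eq]

theorem SameRight.probRight_eq (hs : SameRight c d l u) (h : ℕ) :
    probRight h c l = probRight h d u := by
  rw [probRight, probRight, ← hs.image_eq, Finset.prod_image (hshift_injective _).injOn]
  refine Finset.prod_congr rfl fun v hv => ?_
  rw [hs.stepProb_eq (Finset.mem_filter.1 hv).2]

end SameRight

/-- The trapped walks with a given left part. -/
def cylinder (h c : ℕ) (L : List (ℤ × ℤ)) : Set (List (ℤ × ℤ)) :=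
  {l | IsTrappedWalk h l ∧ leftPart c l = L}

/-- The generating function of the right parts of the walks with a given left part. -/
noncomputable def rightSeries (h c : ℕ) (L : List (ℤ × ℤ)) : MvPowerSeries (Fin 2) ℚ :=
  weightSeries (cylinder h c L) (probRight h c) (degRight c)

/-- What the possible right parts of a walk with a given left part depend on. -/
def interfaceState (h c : ℕ) (l : List (ℤ × ℤ)) : List (ℤ × ℤ) × Prop :=
  (window c l, TrappedLeft h c l)

/-- Exchanging the left part while keeping the right one up to translation is a bijection between
the two cylinders; it preserves all data to the right of the cut. -/
theorem rightSeries_eq_of_interfaceState_eq {h c d : ℕ} {l m : List (ℤ × ℤ)}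
    (hl : IsTrappedWalk h l) (hm : IsTrappedWalk h m)
    (hlm : interfaceState h c l = interfaceState h d m) :
    rightSeries h c (leftPart c l) = rightSeries h d (leftPart d m) := by
  have key : ∀ {c d : ℕ} {l m : List (ℤ × ℤ)}, IsTrappedWalk h m →
      interfaceState h c l = interfaceState h d m → ∀ l' ∈ cylinder h c (leftPart c l),
      ∃ u ∈ cylinder h d (leftPart d m), SameRight c d l' u := by
    rintro c d l m hm hlm l' ⟨hl', hll'⟩
    simp only [interfaceState, Prod.mk.injEq] at hlm
    obtain ⟨u, hu, h1, h2⟩ := exists_splice hl' hm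
      (by rw [← hlm.1, window, window, hll'])
      (by rw [← hlm.2]; exact ⟨trappedLeft_of_leftPart_eq hll',
        trappedLeft_of_leftPart_eq hll'.symm⟩)
    exact ⟨u, ⟨hu, h1⟩, h2⟩
  choose! φ hφ hs using key hm hlm
  refine weightSeries_eq_of_bijOn φ ⟨hφ, ?_, ?_⟩ (fun u hu => (hs u hu).probRight_eq h)
    fun u hu => (hs u hu).degRight_eq
  · intro u hu u' hu' huu
    refine hu.1.eq_of_parts hu'.1 (hu.2.trans hu'.2.symm) ?_
    have h1 := hs u hu
    have h2 := hs u' hu'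
    rw [huu] at h1
    exact (List.map_injective_iff.2 (hshift_injective _)) (Eq.trans h1 (Eq.symm h2))
  · intro w hw
    obtain ⟨u, hu, hwu⟩ := key hl hlm.symm w hw
    refine ⟨u, hu, (hφ u hu).1.eq_of_parts hw.1 ((hφ u hu).2.trans hw.2.symm) ?_⟩
    exact Eq.trans (Eq.symm (hs u hu)) hwu.symm

theorem finite_setOf_nodup {α : Type*} {B : Set α} (hB : B.Finite) :
    {l : List α | l.Nodup ∧ ∀ v ∈ l, v ∈ B}.Finite := by
  classical
  have := hB.fintype
  refine (Set.finite_range fun l : {l : List B // l.Nodup} => l.1.map Subtype.val).subset ?_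
  rintro l ⟨hl, hlB⟩
  exact ⟨⟨l.attach.map fun v => ⟨v.1, hlB v.1 v.2⟩, by
    refine List.Nodup.map (fun v w hvw => ?_) (List.nodup_attach.2 hl)
    exact Subtype.ext (by simpa using hvw)⟩, by simp⟩

theorem finite_setOf_maxFst_le (h n : ℕ) : {l | IsTrappedWalk h l ∧ maxFst l ≤ n}.Finite := by
  refine (finite_setOf_nodup (Set.finite_Icc ((0 : ℤ), (0 : ℤ)) ((n : ℤ), (h : ℤ)))).subset ?_
  rintro l ⟨hl, hn⟩
  rw [maxFst_le_iff] at hn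
  refine ⟨hl.nodup, fun v hv => ?_⟩
  obtain ⟨h1, h2, h3⟩ := hl.mem_strip v hv
  exact ⟨⟨h1, h2⟩, hn v hv, h3.le⟩

theorem finite_setOf_leftPart (h c : ℕ) : {L | ∃ l, IsTrappedWalk h l ∧ leftPart c l = L}.Finite := by
  refine (finite_setOf_nodup
    (Set.finite_Icc ((0 : ℤ), (0 : ℤ)) (((c : ℤ) + 1), (h : ℤ)))).subset ?_
  rintro _ ⟨l, hl, rfl⟩
  refine ⟨hl.nodup.filter _, fun v hv => ?_⟩
  simp only [leftPart, List.mem_filter, decide_eq_true_eq] at hv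
  obtain ⟨h1, h2, h3⟩ := hl.mem_strip v hv.1
  exact ⟨⟨h1, h2⟩, hv.2, h3.le⟩

theorem finite_setOf_interfaceState (h : ℕ) :
    {s | ∃ c l, IsTrappedWalk h l ∧ interfaceState h c l = s}.Finite := by
  refine ((finite_setOf_nodup (Set.finite_Icc ((0 : ℤ), (0 : ℤ)) ((1 : ℤ), (h : ℤ)))).prod
    (Set.finite_univ (α := Prop))).subset ?_
  rintro _ ⟨c, l, hl, rfl⟩
  refine ⟨⟨((hl.nodup.filter _).filter _).map (hshift_injective _), fun v hv => ?_⟩, trivial⟩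
  simp only [interfaceState, window, leftPart, List.mem_map, List.mem_filter,
    decide_eq_true_eq] at hv
  obtain ⟨w, ⟨⟨hw, hw1⟩, hw2⟩, rfl⟩ := hv
  obtain ⟨h1, h2, h3⟩ := hl.mem_strip w hw
  exact ⟨⟨by simp; omega, h2⟩, by simp; omega, h3.le⟩

/-- The exponent of `y` alone bounds the columns reached, and a bounded box carries finitely many
repetition-free lists. -/
theorem finite_degRight_eq (h c : ℕ) (L : List (ℤ × ℤ)) (e : Fin 2 →₀ ℕ) :
    {l | l ∈ cylinder h c L ∧ degRight c l = e}.Finite := by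
  refine (finite_setOf_maxFst_le h (c + e 1)).subset ?_
  rintro l ⟨hl, rfl⟩
  refine ⟨hl.1, ?_⟩
  simp [degRight]
  omega

theorem leftPart_leftPart_succ (c : ℕ) (l : List (ℤ × ℤ)) :
    leftPart c (leftPart (c + 1) l) = leftPart c l := by
  rw [leftPart, leftPart, leftPart, List.filter_filter]
  congr 1
  funext v
  by_cases h1 : v.1 ≤ (c : ℤ) + 1
  · have : v.1 ≤ (c : ℤ) + 1 + 1 := by omega
    simp [h1, this]
  · simp [h1]

/-- A discrete intermediate value theorem for the column. -/
theorem exists_fst_eq_of_isChain {p : ℤ × ℤ} {U : List (ℤ × ℤ)} (hc : (p :: U).IsChain latticeAdj)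
    {e : ℤ} (hp : p.1 ≤ e) (h : ∃ v ∈ p :: U, e ≤ v.1) : ∃ v ∈ p :: U, v.1 = e := by
  induction U generalizing p with
  | nil =>
    obtain ⟨v, hv, hev⟩ := h
    simp only [List.mem_singleton] at hv
    subst hv
    exact ⟨v, by simp, by omega⟩
  | cons a U ih =>
    rcases hp.eq_or_lt with h1 | h1
    · exact ⟨p, by simp, h1⟩
    · rw [List.isChain_cons_cons] at hc
      have := hc.1.fst_bounds
      obtain ⟨v, hv, hev⟩ := h
      rcases List.mem_cons.1 hv with rfl | hv
      · omega
      · obtain ⟨w, hw, hwe⟩ := ih hc.2 (by omega) ⟨v, hv, hev⟩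
        exact ⟨w, List.mem_cons_of_mem _ hw, hwe⟩

theorem IsTrappedWalk.exists_fst_eq {h : ℕ} {l : List (ℤ × ℤ)} (hl : IsTrappedWalk h l) {n : ℕ}
    (hn : n ≤ maxFst l) : ∃ v ∈ l, v.1 = n := by
  have h1 : ∃ v ∈ l, (n : ℤ) ≤ v.1 := by
    by_contra! hcon
    obtain _ | n := n
    · obtain ⟨v, hv, -⟩ := hl.trapped
      have h1 := hcon v hv
      have h2 := (hl.mem_strip v hv).1
      push_cast at h1
      omega
    · have : maxFst l ≤ n := maxFst_le_iff.2 fun v hv => by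
        have := hcon v hv
        push_cast at this
        omega
      omega
  obtain _ | ⟨a, l⟩ := l
  · simp at h1
  · have h2 := hl.head
    simp only [List.head?_cons, Option.some.injEq] at h2
    exact exists_fst_eq_of_isChain hl.chain (by simp [h2]) h1

section LeftPart

variable {c : ℕ} {l u : List (ℤ × ℤ)} {p : ℤ × ℤ → Prop} [DecidablePred p]

theorem filter_toFinset_eq_of_leftPart_eq (hlu : leftPart c l = leftPart c u)
    (hp : ∀ v, p v → v.1 ≤ c) : {v ∈ l.toFinset | p v} = {v ∈ u.toFinset | p v} := by
  have key : ∀ l, {v ∈ List.toFinset l | p v} = {v ∈ (leftPart c l).toFinset | p v} := by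
    intro l
    ext v
    simp only [leftPart, Finset.mem_filter, List.mem_toFinset, List.mem_filter, decide_eq_true_eq]
    have := hp v
    constructor
    · rintro ⟨h1, h2⟩
      exact ⟨⟨h1, by have := this h2; omega⟩, h2⟩
    · rintro ⟨h1, h2⟩
      exact ⟨h1.1, h2⟩
  rw [key l, hlu, ← key u]

theorem prod_stepProb_eq_of_leftPart_eq (h : ℕ) (hlu : leftPart c l = leftPart c u)
    (hp : ∀ v, p v → v.1 ≤ c) :
    ∏ v ∈ l.toFinset with p v, stepProb h l v = ∏ v ∈ u.toFinset with p v, stepProb h u v := by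
  rw [filter_toFinset_eq_of_leftPart_eq hlu hp]
  refine Finset.prod_congr rfl fun v hv => ?_
  have hv := hp v (Finset.mem_filter.1 hv).2
  simp only [stepProb]
  rw [← openSet_leftPart l hv, hlu, openSet_leftPart u hv]

end LeftPart

/-- Column `c + 1` and the step probabilities at its vertices are read off the left part at `c + 1`,
so they are constant on the cylinder and factor out. -/
theorem rightSeries_succ_of_exists {h c : ℕ} {l : List (ℤ × ℤ)}
    (hlc : c + 1 ≤ maxFst l) (hl : IsTrappedWalk h l) :
    weightSeries (cylinder h (c + 1) (leftPart (c + 1) l)) (probRight h c) (degRight c) =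
      MvPowerSeries.monomial
        (Finsupp.single 0 {v ∈ l.toFinset | v.1 = (c : ℤ) + 1}.card + Finsupp.single 1 1)
        (∏ v ∈ l.toFinset with v.1 = (c : ℤ) + 1, stepProb h l v) *
          rightSeries h (c + 1) (leftPart (c + 1) l) := by
  have hp : ∀ v : ℤ × ℤ, v.1 = (c : ℤ) + 1 → v.1 ≤ (c + 1 : ℕ) := fun v hv => by
    push_cast
    omega
  have hsplit : ∀ u : List (ℤ × ℤ), {v ∈ u.toFinset | (c : ℤ) < v.1} =
      {v ∈ u.toFinset | v.1 = (c : ℤ) + 1} ∪ {v ∈ u.toFinset | ((c + 1 : ℕ) : ℤ) < v.1} := by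
    intro u
    ext v
    simp only [Finset.mem_union, Finset.mem_filter]
    push_cast
    rw [← and_or_left]
    exact and_congr_right fun _ => by omega
  have hdisj : ∀ u : List (ℤ × ℤ), Disjoint {v ∈ u.toFinset | v.1 = (c : ℤ) + 1}
      {v ∈ u.toFinset | ((c + 1 : ℕ) : ℤ) < v.1} := fun u =>
    Finset.disjoint_filter.2 fun v _ h1 h2 => by push_cast at h2; omega
  refine weightSeries_shift _ _ (fun u hu => ?_) fun u hu => ?_
  · rw [probRight, hsplit, Finset.prod_union (hdisj u), probRight,
      prod_stepProb_eq_of_leftPart_eq h hu.2 hp]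
  · obtain ⟨v, hv, hvc⟩ := hl.exists_fst_eq hlc
    have hvu : v ∈ u := by
      have h1 : v ∈ leftPart (c + 1) l := by simp [leftPart, hv, hvc]
      rw [← hu.2] at h1
      exact List.mem_of_mem_filter h1
    -- This makes the truncated subtraction `maxFst u - (c + 1)` exact and yields the factor `y`.
    have hmax : c + 1 ≤ maxFst u := by
      by_contra! hcon
      have := maxFst_le_iff.1 (Nat.lt_succ_iff.1 hcon) v hvu
      push_cast at hvc
      omega
    rw [degRight, degRight, cardRight, hsplit, Finset.card_union_of_disjoint (hdisj u),
      filter_toFinset_eq_of_leftPart_eq hu.2 hp, ← cardRight, Finsupp.single_add,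
      show maxFst u - c = 1 + (maxFst u - (c + 1)) by omega, Finsupp.single_add]
    abel

/-- The interface states of trapped walks. -/
def stateSet (h : ℕ) : Set (List (ℤ × ℤ) × Prop) :=
  {s | ∃ c l, IsTrappedWalk h l ∧ interfaceState h c l = s}

theorem exists_stateSeries (h : ℕ) : ∃ G : stateSet h → MvPowerSeries (Fin 2) ℚ,
    ∀ c l, ∀ hl : IsTrappedWalk h l,
      rightSeries h c (leftPart c l) = G ⟨interfaceState h c l, c, l, hl, rfl⟩ := by
  choose c l hl hs using fun s : stateSet h => s.2
  refine ⟨fun s => rightSeries h (c s) (leftPart (c s) (l s)), fun d m hm => ?_⟩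
  exact rightSeries_eq_of_interfaceState_eq hm (hl _) (hs ⟨_, d, m, hm, rfl⟩).symm

theorem pairwiseDisjoint_cylinder (h c : ℕ) (T : Set (List (ℤ × ℤ))) :
    T.PairwiseDisjoint (cylinder h c) := fun _ _ _ _ hLL =>
  Set.disjoint_left.2 fun _ h1 h2 => hLL (h1.2.symm.trans h2.2)

/-- The finitely many walks that stop by column `c` give the polynomial; the others are sorted by
their left part at `c + 1`. -/
theorem isAffineOver_rightSeries {h : ℕ} [Fintype (stateSet h)]
    {G : stateSet h → MvPowerSeries (Fin 2) ℚ} (hG : ∀ c l, ∀ hl : IsTrappedWalk h l,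
      rightSeries h c (leftPart c l) = G ⟨interfaceState h c l, c, l, hl, rfl⟩)
    (c : ℕ) (L : List (ℤ × ℤ)) : IsAffineOver G (rightSeries h c L) := by
  set S : Set (List (ℤ × ℤ)) := {L' | ∃ l ∈ cylinder h c L, c + 1 ≤ maxFst l ∧
    leftPart (c + 1) l = L'} with hS
  have hSfin : S.Finite := (finite_setOf_leftPart h (c + 1)).subset fun L' ⟨l, hl, _, h2⟩ =>
    ⟨l, hl.1, h2⟩
  have hfin : {l | l ∈ cylinder h c L ∧ maxFst l ≤ c}.Finite :=
    (finite_setOf_maxFst_le h c).subset fun l hl => ⟨hl.1.1, hl.2⟩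
  have hsub : ∀ L' ∈ S, cylinder h (c + 1) L' ⊆ cylinder h c L := by
    rintro _ ⟨l, hl, -, rfl⟩ u hu
    exact ⟨hu.1, by rw [← leftPart_leftPart_succ, hu.2, leftPart_leftPart_succ, hl.2]⟩
  have hmax : ∀ L' ∈ S, ∀ u ∈ cylinder h (c + 1) L', c < maxFst u := by
    rintro _ ⟨l, hl, hlc, rfl⟩ u hu
    obtain ⟨v, hv, hvc⟩ := hl.1.exists_fst_eq hlc
    have h1 : v ∈ leftPart (c + 1) l := by simp [leftPart, hv, hvc]
    rw [← hu.2] at h1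
    by_contra! hcon
    have := maxFst_le_iff.1 hcon v (List.mem_of_mem_filter h1)
    push_cast at hvc
    omega
  have hunion : cylinder h c L = {l | l ∈ cylinder h c L ∧ maxFst l ≤ c} ∪
      ⋃ L' ∈ hSfin.toFinset, cylinder h (c + 1) L' := by
    ext l
    simp only [Set.mem_union, Set.mem_ofPred_eq, Set.mem_iUnion, Set.Finite.mem_toFinset,
      exists_prop]
    constructor
    · intro hl
      rcases le_or_gt (maxFst l) c with h1 | h1
      · exact Or.inl ⟨hl, h1⟩
      · exact Or.inr ⟨leftPart (c + 1) l, ⟨l, hl, h1, rfl⟩, hl.1, rfl⟩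
    · rintro (hl | ⟨L', hL', hl⟩)
      · exact hl.1
      · exact hsub L' hL' hl
  rw [rightSeries, hunion, weightSeries_union, weightSeries_biUnion]
  · refine IsAffineOver.add ?_ (isAffineOver_sum _ _ fun L' hL' => ?_)
    · obtain ⟨P, hP⟩ := weightSeries_of_finite hfin (probRight h c) (degRight c)
      rw [hP]
      exact isAffineOver_coe P
    · rw [Set.Finite.mem_toFinset] at hL'
      obtain ⟨l, hl, hlc, rfl⟩ := hL'
      rw [rightSeries_succ_of_exists hlc hl.1, hG (c + 1) l hl.1, ← MvPolynomial.coe_monomial]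
      refine isAffineOver_coe_mul _ _ ?_
      -- The monomial contains `y` to the power 1, so it has no constant term.
      rw [MvPolynomial.constantCoeff_monomial, if_neg]
      intro h0
      simpa using DFunLike.congr_fun h0 1
  · exact pairwiseDisjoint_cylinder h _ _
  · intro L' hL' e
    rw [Set.Finite.mem_toFinset] at hL'
    exact (finite_degRight_eq h c L e).subset fun l hl => ⟨hsub L' hL' hl.1, hl.2⟩
  · rw [Set.disjoint_left]
    intro l hl hl'
    simp only [Set.mem_iUnion, Set.Finite.mem_toFinset, exists_prop] at hl'
    obtain ⟨L', hL', hl'⟩ := hl'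
    exact absurd hl.2 (not_le.2 (hmax L' hL' l hl'))
  · exact fun e => hfin.subset fun l hl => hl.1
  · refine fun e => (finite_degRight_eq h c L e).subset fun l hl => ⟨?_, hl.2⟩
    rw [hunion]
    exact Or.inr hl.1

/-- Sort the walks by their left part at `c = 0`; column `0` contributes a constant monomial on each
cylinder. -/
theorem isRationalSeries_weightSeries (h : ℕ) :
    IsRationalSeries (weightSeries {l | IsTrappedWalk h l} (fun l => ∏ v ∈ l.toFinset, stepProb h l v)
      fun l => Finsupp.single (0 : Fin 2) (l.length - 1) + Finsupp.single 1 (maxFst l)) := by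
  have hfin := finite_setOf_leftPart h 0
  have : Fintype (stateSet h) := (finite_setOf_interfaceState h).fintype
  obtain ⟨G, hG⟩ := exists_stateSeries h
  have hunion : {l | IsTrappedWalk h l} = ⋃ L ∈ hfin.toFinset, cylinder h 0 L := by
    ext l
    simp only [Set.mem_ofPred_eq, Set.mem_iUnion, Set.Finite.mem_toFinset, exists_prop]
    exact ⟨fun hl => ⟨_, ⟨l, hl, rfl⟩, hl, rfl⟩, fun ⟨L, _, hl⟩ => hl.1⟩
  rw [hunion, weightSeries_biUnion]
  · have haff : ∀ s, IsAffineOver G (G s) := by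
      rintro ⟨_, c, l, hl, rfl⟩
      rw [← hG c l hl]
      exact isAffineOver_rightSeries hG c _
    choose l hl hlL using fun L : hfin.toFinset => (Set.Finite.mem_toFinset hfin).1 L.2
    rw [← Finset.sum_attach]
    refine isRationalSeries_of_isAffineOver haff hfin.toFinset hfin.toFinset.attach
      (fun L => MvPolynomial.monomial
        -- A walk has one edge fewer than vertices; the correction is made in column `0`, which
        -- contains the start and is never empty.
        (Finsupp.single 0 ({v ∈ (l L).toFinset | v.1 ≤ ((0 : ℕ) : ℤ)}.card - 1))
        (∏ v ∈ (l L).toFinset with v.1 ≤ ((0 : ℕ) : ℤ), stepProb h (l L) v))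
      (fun L => ⟨interfaceState h 0 (l L), 0, l L, hl L, rfl⟩)
      (Finset.sum_congr rfl fun L _ => ?_)
    rw [← hG 0 (l L) (hl L), MvPolynomial.coe_monomial, hlL L]
    refine weightSeries_shift _ _ (fun u hu => ?_) fun u hu => ?_
    · rw [← prod_stepProb_eq_of_leftPart_eq h (hu.2.trans (hlL L).symm) (fun v hv => hv),
        probRight, ← Finset.prod_filter_mul_prod_filter_not _ fun v => v.1 ≤ ((0 : ℕ) : ℤ)]
      simp only [not_le]
    · rw [← filter_toFinset_eq_of_leftPart_eq (hu.2.trans (hlL L).symm) (fun v hv => hv),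
        degRight, tsub_zero, ← add_assoc, ← Finsupp.single_add, cardRight]
      congr 2
      rw [← List.toFinset_card_of_nodup hu.1.nodup,
        ← Finset.card_filter_add_card_filter_not (s := u.toFinset)
          fun v => v.1 ≤ ((0 : ℕ) : ℤ)]
      simp only [not_le]
      have : 0 < {v ∈ u.toFinset | v.1 ≤ ((0 : ℕ) : ℤ)}.card := by
        obtain ⟨v, hv, hv0⟩ := hu.1.exists_fst_eq (Nat.zero_le _)
        exact Finset.card_pos.2 ⟨v, by simp [hv]; exact hv0.le⟩
      omega
  · exact pairwiseDisjoint_cylinder h _ _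
  · refine fun L _ e => (finite_setOf_maxFst_le h (e 1)).subset ?_
    rintro l ⟨hl, rfl⟩
    exact ⟨hl.1, by simp⟩

end Transfer

/-! ### From walks to vertex lists -/

section Lists

theorem pair_getElem_sublist_iff {α : Type*} {l : List α} (hl : l.Nodup) {i : ℕ}
    (hi : i < l.length) (u : α) : [u, l[i]].Sublist l ↔ ∃ j, ∃ hj : j < i, u = l[j] := by
  induction l generalizing i with
  | nil => simp at hi
  | cons a t ih =>
    rw [List.nodup_cons] at hl
    rw [List.cons_sublist_cons']
    obtain _ | i := i
    · simp only [List.getElem_cons_zero, List.singleton_sublist, Nat.not_lt_zero, exists_false,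
        IsEmpty.exists_iff, iff_false, not_or, not_and]
      exact ⟨fun h => hl.1 (h.subset (by simp)), fun _ => hl.1⟩
    · simp only [List.length_cons, Nat.add_lt_add_iff_right] at hi
      rw [List.getElem_cons_succ, ih hl.2 hi]
      constructor
      · rintro (⟨j, hj, rfl⟩ | ⟨rfl, -⟩)
        · exact ⟨j + 1, by omega, by simp⟩
        · exact ⟨0, by omega, by simp⟩
      · rintro ⟨_ | j, hj, hu⟩
        · exact Or.inr ⟨by simpa using hu, by simp⟩
        · exact Or.inl ⟨j, by omega, by simpa using hu⟩

variable {h : ℕ} {l : List (ℤ × ℤ)}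

/-- The next vertex is always an open neighbour, so a vertex with empty `openSet` can only be the
last one. -/
theorem getElem_succ_mem_openSet (hc : l.IsChain latticeAdj) (hn : l.Nodup)
    (hs : ∀ v ∈ l, v ∈ strip h) {i : ℕ} (hi : i + 1 < l.length) :
    l[i + 1] ∈ openSet h l l[i] := by
  refine ⟨hs _ (List.getElem_mem hi), List.isChain_iff_getElem.1 hc i hi, ?_⟩
  rw [pair_getElem_sublist_iff hn]
  rintro ⟨j, hj, hij⟩
  have := hn.getElem_inj_iff.1 hij
  omega

end Lists

namespace GSAW

variable {h : ℕ} {v : strip h}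

/-- The list of the points visited by a walk. -/
def toList (W : GSAW (gridGraph (strip h)) v) : List (ℤ × ℤ) := W.walk.support.map Subtype.val

variable (W : GSAW (gridGraph (strip h)) v)

@[simp] theorem length_toList : W.toList.length = W.length + 1 := by
  simp [toList, length]

theorem getElem_toList {i : ℕ} (hi : i < W.toList.length) : W.toList[i] = (W.vertex i).1 := by
  simp only [length_toList] at hi
  simp only [toList, vertex, List.getElem_map]
  rw [SimpleGraph.Walk.getVert_eq_support_getElem _ (Nat.lt_succ_iff.1 hi)]

theorem nodup_toList : W.toList.Nodup :=
  W.isPath.support_nodup.map Subtype.val_injective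

theorem isChain_toList : W.toList.IsChain latticeAdj := by
  rw [toList, List.isChain_map]
  exact W.walk.isChain_adj_support

theorem mem_strip_of_mem_toList : ∀ u ∈ W.toList, u ∈ strip h := by
  intro u hu
  obtain ⟨w, -, rfl⟩ := List.mem_map.1 hu
  exact w.2

theorem openSet_toList {i : ℕ} (hi : i ≤ W.length) :
    openSet h W.toList (W.vertex i).1 = Subtype.val '' W.openNeighbours i := by
  have hi' : i < W.toList.length := by simp; omega
  ext u
  rw [← W.getElem_toList hi']
  simp only [openSet, Set.mem_ofPred_eq, pair_getElem_sublist_iff W.nodup_toList hi',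
    openNeighbours, Set.mem_image, not_exists]
  constructor
  · rintro ⟨h1, h2, h3⟩
    refine ⟨⟨u, h1⟩, ⟨?_, fun j hj huj => ?_⟩, rfl⟩
    · rw [W.getElem_toList hi'] at h2
      exact h2
    · rcases hj.lt_or_eq with hj | rfl
      · exact h3 j hj (by rw [W.getElem_toList, ← huj])
      · rw [W.getElem_toList hi', ← huj] at h2
        simp [latticeAdj] at h2
  · rintro ⟨u, ⟨h1, h2⟩, rfl⟩
    refine ⟨u.2, ?_, fun j hj huj => ?_⟩
    · rw [W.getElem_toList hi']
      exact h1
    · rw [W.getElem_toList] at huj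
      exact h2 j hj.le (Subtype.ext huj)

theorem openNeighbours_length : W.openNeighbours W.length = ∅ := by
  ext u
  simp only [openNeighbours, Set.mem_ofPred_eq, Set.mem_empty_iff_false, iff_false, not_and]
  intro hu hcon
  have h1 : W.vertex W.length = W.endpoint := W.walk.getVert_length
  rw [h1] at hu
  obtain ⟨n, hn, hnl⟩ := SimpleGraph.Walk.mem_support_iff_exists_getVert.1 (W.trapped u hu)
  exact hcon n hnl hn.symm

theorem prod_stepProb_toList :
    ∏ u ∈ W.toList.toFinset, stepProb h W.toList u = W.uniformProb := by
  have hmap : W.toList.map (stepProb h W.toList) =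
      List.ofFn fun i : Fin (W.length + 1) => stepProb h W.toList (W.vertex i).1 :=
    List.ext_getElem (by simp) fun i h1 h2 => by
      rw [List.getElem_map, W.getElem_toList, List.getElem_ofFn]
  rw [List.prod_toFinset _ W.nodup_toList, hmap, List.prod_ofFn,
    ← Finset.prod_range fun i => stepProb h W.toList (W.vertex i).1, Finset.prod_range_succ,
    stepProb, W.openSet_toList le_rfl, W.openNeighbours_length, Set.image_empty, if_pos rfl,
    mul_one, uniformProb]
  refine Finset.prod_congr rfl fun i hi => ?_
  have hi := Finset.mem_range.1 hi
  have hne : (W.vertex (i + 1)).1 ∈ openSet h W.toList (W.vertex i).1 := by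
    rw [← W.getElem_toList (i := i) (by simp; omega), ← W.getElem_toList (by simp; omega)]
    exact getElem_succ_mem_openSet W.isChain_toList W.nodup_toList W.mem_strip_of_mem_toList _
  rw [stepProb, if_neg (Set.nonempty_of_mem hne).ne_empty, W.openSet_toList hi.le,
    Set.ncard_image_of_injective _ Subtype.val_injective]

/-- The walk starts in column `0`, which is the smallest one possible. -/
theorem maxFst_toList (h0 : v.1.1 = 0) : maxFst W.toList = W.displacement := by
  have h1 : (Finset.range (W.length + 1)).inf' Finset.nonempty_range_add_one
      (fun i => (W.vertex i).1.1) = 0 := by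
    refine le_antisymm ?_ (Finset.le_inf' _ _ fun i _ => (W.vertex i).2.1)
    refine (Finset.inf'_le _ (Finset.mem_range.2 (Nat.succ_pos _))).trans ?_
    have : W.vertex 0 = v := W.walk.getVert_zero
    rw [this, h0]
  rw [displacement, h1, sub_zero]
  refine eq_of_forall_ge_iff fun n => ?_
  rw [maxFst_le_iff, Int.toNat_le, Finset.sup'_le_iff, List.forall_mem_iff_getElem]
  simp only [Finset.mem_range, length_toList]
  exact forall_congr' fun i => forall_congr' fun hi => by rw [W.getElem_toList]

end GSAW

theorem bijOn_toList (h : ℕ) (hh : 1 ≤ h) :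
    Set.BijOn (GSAW.toList (v := topLeft h hh)) Set.univ {l | IsTrappedWalk h l} := by
  refine ⟨fun W _ => ⟨?_, W.isChain_toList, W.nodup_toList, W.mem_strip_of_mem_toList, ?_⟩, ?_, ?_⟩
  · rw [List.head?_eq_getElem?, List.getElem?_eq_getElem (by simp), W.getElem_toList]
    have : W.vertex 0 = topLeft h hh := W.walk.getVert_zero
    rw [this]
    rfl
  · refine ⟨(W.vertex W.length).1, ?_, ?_⟩
    · rw [← W.getElem_toList (by simp)]
      exact List.getElem_mem _
    · rw [W.openSet_toList le_rfl, W.openNeighbours_length, Set.image_empty]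
  · intro W _ W' _ hWW
    have hlen : W.length = W'.length := by
      have := congrArg List.length hWW
      simpa using this
    refine GSAW.ext_vertex W W' hlen fun i hi => Subtype.ext ?_
    rw [← W.getElem_toList (by simp; omega), ← W'.getElem_toList (by simp; omega)]
    simp only [hWW]
  · intro l hl
    have hne : l ≠ [] := by
      rintro rfl
      simpa using hl.head
    obtain ⟨l', rfl⟩ : ∃ l' : List (strip h), l'.map Subtype.val = l :=
      ⟨l.attach.map fun u => ⟨u.1, hl.mem_strip u.1 u.2⟩, by
        rw [List.map_map]
        exact List.attach_map_subtype_val l⟩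
    have hne' : l' ≠ [] := by simpa using hne
    have hchain : l'.IsChain (gridGraph (strip h)).Adj := by
      have := hl.chain
      rw [List.isChain_map] at this
      exact this
    have hnodup : l'.Nodup := hl.nodup.of_map _
    have hhead : l'.head hne' = topLeft h hh := by
      have := hl.head
      rw [List.head?_map, List.head?_eq_some_head hne'] at this
      simp only [Option.map_some, Option.some.injEq] at this
      exact Subtype.ext this
    let p := SimpleGraph.Walk.ofSupport l' hne' hchain
    have hp : p.support = l' := SimpleGraph.Walk.support_ofSupport hne' hchain
    refine ⟨⟨l'.getLast hne', p.copy hhead rfl, ?_, fun w hw => ?_⟩, trivial, ?_⟩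
    · rw [SimpleGraph.Walk.isPath_def, SimpleGraph.Walk.support_copy, hp]
      exact hnodup
    · rw [SimpleGraph.Walk.support_copy, hp]
      obtain ⟨u, hu, hopen⟩ := hl.trapped
      obtain ⟨i, hi, rfl⟩ := List.getElem_of_mem hu
      -- The trapped vertex must be the endpoint, since any other vertex has its successor as an
      -- open neighbour.
      have hi' : i + 1 = (l'.map Subtype.val).length := by
        by_contra hcon
        have := getElem_succ_mem_openSet hl.chain hl.nodup hl.mem_strip (h := h) (i := i) (by omega)
        rw [hopen] at this
        exact this
      have hlast : (l'.getLast hne').1 = (l'.map Subtype.val)[i] := by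
        rw [List.getLast_eq_getElem, List.getElem_map]
        congr 2
        simp at hi'
        omega
      by_contra hwl
      have : w.1 ∈ openSet h (l'.map Subtype.val) (l'.map Subtype.val)[i] := by
        refine ⟨w.2, hlast ▸ hw, fun hsub => hwl ?_⟩
        have := hsub.subset (List.mem_cons_self)
        simpa using this
      rw [hopen] at this
      exact this
    · simp only [GSAW.toList, SimpleGraph.Walk.support_copy, hp]

theorem uniformGenFun_eq (h : ℕ) (hh : 1 ≤ h) :
    uniformGenFun (strip h) (topLeft h hh) =
      weightSeries {l | IsTrappedWalk h l} (fun l => ∏ v ∈ l.toFinset, stepProb h l v)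
        fun l => Finsupp.single (0 : Fin 2) (l.length - 1) + Finsupp.single 1 (maxFst l) := by
  rw [← weightSeries_eq_of_bijOn (s := Set.univ) (w := GSAW.uniformProb)
    (deg := fun W => Finsupp.single (0 : Fin 2) W.length + Finsupp.single 1 W.displacement)
    _ (bijOn_toList h hh) (fun W _ => W.prod_stepProb_toList.symm) fun W _ => by
      simp [W.maxFst_toList rfl]]
  ext e
  rw [coeff_weightSeries]
  refine (finsum_mem_eq_finite_toFinset_sum _
    (GSAW.finite_length_displacement (v := topLeft h hh) (e 0) (e 1))).symm.trans
      (finsum_mem_congr ?_ fun _ _ => rfl)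
  ext W
  simp only [Set.mem_ofPred_eq, Set.mem_univ, true_and]
  constructor
  · rintro ⟨h1, h2⟩
    ext i
    fin_cases i <;> simp [h1, h2]
  · rintro rfl
    simp

theorem mainTheorem3 (h : ℕ) (hh : 1 ≤ h) :
    IsRationalSeries (uniformGenFun (strip h) (topLeft h hh)) := by
  rw [uniformGenFun_eq]
  exact isRationalSeries_weightSeries h
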